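/- Let $b_3$ be the Hall-Thue word, that is, the unique infinite word over $\{0,1,2\}$ that starts with $0$ and is fixed by the morphism $0\mapsto 012,\ 1\mapsto 02,\ 2\mapsto 1$. Let $g_4$ be the morphism from $\{0,1,2\}^*$ to $\{0,1\}^*$ defined by $$g_4(0)=00010011000111011,\qquad g_4(1)=000100111011,\qquad g_4(2)=00111.$$ A repetition is a finite word of the form $r=u^nv$, where $n \ge 0$, $u$ is non-empty and $v$ is a prefix of $u$; its period is $|u|$ and its exponent is $|r|/|u|$. A square is a repetition of exponent $2$, an overlap is a repetition of exponent strictly greater than $2$, and a word is $3^+$-free if none of its factors is a repetition of exponent strictly greater than $3$. There exists an infinite binary word $w$ such that $w$ is $3^+$-free, exactly two distinct overlaps and exactly four distinct squares occur as factors of $w$, and no factor of $w$ is a square of even period. Moreover, the word $w=g_4(b_3)$ has these properties. -/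

import Mathlib

namespace InfWord

/-- The finite factor `w i, w (i+1), …, w (i+n-1)` of the (right-)infinite word `w`. -/
def factorAt {α : Type*} (w : ℕ → α) (i n : ℕ) : List α :=
  (List.range n).map fun j => w (i + j)

/-- The finite word `r` is a factor of the infinite word `w`. -/
def IsFactor {α : Type*} (r : List α) (w : ℕ → α) : Prop :=
  ∃ i, r = factorAt w i r.length

/-- `r = uⁿ v` where `u` is non-empty of length `p` and `v` is a prefix of `u`:
the word `r` is a repetition of period `p`. -/
def IsRepetition {α : Type*} (r : List α) (p : ℕ) : Prop :=
  ∃ (u v : List α) (n : ℕ), u ≠ [] ∧ v <+: u ∧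
    r = (List.replicate n u).flatten ++ v ∧ u.length = p

/-- The exponent `|r| / p` of a repetition `r` of period `p`. -/
def exponent {α : Type*} (r : List α) (p : ℕ) : ℚ :=
  (r.length : ℚ) / (p : ℚ)

/-- `r` is a square of period `p`: a repetition of period `p` and exponent `2`. -/
def IsSquareOfPeriod {α : Type*} (r : List α) (p : ℕ) : Prop :=
  IsRepetition r p ∧ exponent r p = 2

/-- `r` is a square. -/
def IsSquareWord {α : Type*} (r : List α) : Prop :=
  ∃ p, IsSquareOfPeriod r p

/-- `r` is an overlap: a repetition with exponent strictly greater than `2`. -/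
def IsOverlap {α : Type*} (r : List α) : Prop :=
  ∃ p, IsRepetition r p ∧ 2 < exponent r p

/-- `w` is `e⁺`-free: no factor of `w` is a repetition with exponent strictly greater than `e`. -/
def IsPlusFree {α : Type*} (e : ℚ) (w : ℕ → α) : Prop :=
  ∀ r p, IsFactor r w → IsRepetition r p → exponent r p ≤ e

/-- `y = m(x)` for infinite words `x`, `y`, where the morphism of free monoids extending
`m : α → List β` is `List.flatMap m`: the images of the finite prefixes of `x`
are prefixes of `y` of unbounded length. -/
def IsImage {α β : Type*} (m : α → List β) (x : ℕ → α) (y : ℕ → β) : Prop :=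
  (∀ n, (factorAt x 0 n).flatMap m = factorAt y 0 ((factorAt x 0 n).flatMap m).length) ∧
    ∀ L, ∃ n, L ≤ ((factorAt x 0 n).flatMap m).length

/-- The morphism `0 ↦ 012`, `1 ↦ 02`, `2 ↦ 1`. -/
def hallThueMorphism : Fin 3 → List (Fin 3) :=
  ![[0, 1, 2], [0, 2], [1]]

/-- `b` is the Hall-Thue word `b₃`: the fixed point of `012/02/1` (starting with `0`). -/
def IsHallThue (b : ℕ → Fin 3) : Prop :=
  b 0 = 0 ∧ IsImage hallThueMorphism b b

/-- The morphism `g₄`. -/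
def g4 : Fin 3 → List (Fin 2) :=
  ![[0, 0, 0, 1, 0, 0, 1, 1, 0, 0, 0, 1, 1, 1, 0, 1, 1],
    [0, 0, 0, 1, 0, 0, 1, 1, 1, 0, 1, 1],
    [0, 0, 1, 1, 1]]

end InfWord

/-! The Thue-Morse word `t` is overlap-free, so its difference coding, the Hall-Thue word `b`, is
square-free; the coding also makes `010` and `212` impossible. Let `w` be the image of `b` under
`g4`.

Squares of period less than 26 in `w` are found by computation: `g4_hasFewShortSquares` inspects the
images of a finite superset of the factors of `b` of length 8. Only `00`, `11`, `001001` and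
`110110` survive, and the cubes `000` and `111` are the only overlaps.

Longer squares do not exist (`not_squareAt_of_le`). By `g4_synchronizing`, nine letters of `w`
locate block boundaries, so a long square lifts to two occurrences in `b` of a word `x`. Since `b`
is square-free, these are neither adjacent nor overlapping. The blocks have different lengths and
short common prefixes and suffixes, which leaves only `0x1x0`. There `x` must begin and end with
`2`, so `212` would occur in `b`. -/

namespace InfWord

/-! ### Factors, morphic images and repetitions of infinite words -/

section Factors

variable {α β : Type*}

@[simp]
theorem length_factorAt (w : ℕ → α) (i n : ℕ) : (factorAt w i n).length = n := by
  simp [factorAt]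

@[simp]
theorem getElem_factorAt (w : ℕ → α) (i n j : ℕ) (h : j < (factorAt w i n).length) :
    (factorAt w i n)[j] = w (i + j) := by
  simp [factorAt]

theorem factorAt_add (w : ℕ → α) (i n d : ℕ) :
    factorAt w i (n + d) = factorAt w i n ++ factorAt w (i + n) d := by
  simp [factorAt, List.range_add, Function.comp_def, add_assoc]

theorem factorAt_zero (w : ℕ → α) (i : ℕ) : factorAt w i 0 = [] := rfl

theorem factorAt_one (w : ℕ → α) (i : ℕ) : factorAt w i 1 = [w i] := by
  simp [factorAt]

theorem factorAt_succ (w : ℕ → α) (i n : ℕ) :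
    factorAt w i (n + 1) = w i :: factorAt w (i + 1) n := by
  rw [add_comm, factorAt_add, factorAt_one, List.singleton_append]

theorem factorAt_succ_last (w : ℕ → α) (i n : ℕ) :
    factorAt w i (n + 1) = factorAt w i n ++ [w (i + n)] := by
  rw [factorAt_add, factorAt_one]

theorem factorAt_eq_iff (w : ℕ → α) (i k n : ℕ) :
    factorAt w i n = factorAt w k n ↔ ∀ j < n, w (i + j) = w (k + j) := by
  simp [factorAt]

theorem take_factorAt (w : ℕ → α) (i : ℕ) {d n : ℕ} (h : d ≤ n) :
    (factorAt w i n).take d = factorAt w i d := by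
  apply List.ext_getElem <;> simp [h]

theorem drop_factorAt (w : ℕ → α) (i d n : ℕ) :
    (factorAt w i n).drop d = factorAt w (i + d) (n - d) := by
  apply List.ext_getElem <;> simp [add_assoc]

/-- The position in `m(x)` at which the image of the `n`-th letter of `x` starts. -/
def blockStart (m : α → List β) (x : ℕ → α) (n : ℕ) : ℕ :=
  ((factorAt x 0 n).flatMap m).length

@[simp]
theorem blockStart_zero (m : α → List β) (x : ℕ → α) : blockStart m x 0 = 0 := by
  simp [blockStart, factorAt]

theorem blockStart_succ (m : α → List β) (x : ℕ → α) (n : ℕ) :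
    blockStart m x (n + 1) = blockStart m x n + (m (x n)).length := by
  simp [blockStart, factorAt_succ_last, -List.length_flatMap]

theorem blockStart_strictMono {m : α → List β} (hm : ∀ a, m a ≠ []) (x : ℕ → α) :
    StrictMono (blockStart m x) := by
  refine strictMono_nat_of_lt_succ fun n => ?_
  have := List.length_pos_iff.2 (hm (x n))
  rw [blockStart_succ]
  omega

theorem exists_mem_block {m : α → List β} (hm : ∀ a, m a ≠ []) (x : ℕ → α) (k : ℕ) :
    ∃ n o, o < (m (x n)).length ∧ k = blockStart m x n + o := by
  have hex : ∃ n, k < blockStart m x n :=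
    ⟨k + 1, (Nat.lt_succ_self k).trans_le (blockStart_strictMono hm x).le_apply⟩
  obtain ⟨n, hn⟩ : ∃ n, Nat.find hex = n + 1 :=
    Nat.exists_eq_succ_of_ne_zero fun h => by
      have := Nat.find_spec hex
      simp [h] at this
  have h1 := Nat.find_spec hex
  have h2 := Nat.find_min hex (m := n) (by omega)
  rw [hn, blockStart_succ] at h1
  exact ⟨n, k - blockStart m x n, by omega, by omega⟩

/-- `y` is built from the blocks `m (x n)`. -/
def IsBlockwiseImage (m : α → List β) (x : ℕ → α) (y : ℕ → β) : Prop :=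
  ∀ n, factorAt y (blockStart m x n) (m (x n)).length = m (x n)

theorem IsBlockwiseImage.factorAt_blockStart {m : α → List β} {x : ℕ → α} {y : ℕ → β}
    (h : IsBlockwiseImage m x y) (n d : ℕ) :
    factorAt y (blockStart m x n) ((factorAt x n d).flatMap m).length =
      (factorAt x n d).flatMap m := by
  induction d generalizing n with
  | zero => simp [factorAt]
  | succ d ih =>
    have := ih (n + 1)
    rw [blockStart_succ] at this
    rw [factorAt_succ, List.flatMap_cons, List.length_append, factorAt_add, h n, this]

theorem IsBlockwiseImage.isImage {m : α → List β} (hm : ∀ a, m a ≠ []) {x : ℕ → α} {y : ℕ → β}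
    (h : IsBlockwiseImage m x y) : IsImage m x y := by
  refine ⟨fun n => ?_, fun L => ⟨L, (blockStart_strictMono hm x).le_apply⟩⟩
  have := h.factorAt_blockStart 0 n
  rw [blockStart_zero] at this
  exact this.symm

theorem IsBlockwiseImage.getElem? {m : α → List β} {x : ℕ → α} {y : ℕ → β}
    (h : IsBlockwiseImage m x y) {n o : ℕ} (ho : o < (m (x n)).length) :
    (m (x n))[o]? = some (y (blockStart m x n + o)) := by
  have h' := h n
  rw [← h', List.getElem?_eq_getElem (by simpa using ho), getElem_factorAt]

/-- The image of an infinite word under a non-erasing morphism. -/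
def image [Inhabited β] (m : α → List β) (x : ℕ → α) (k : ℕ) : β :=
  -- When all blocks are non-empty, `k + 1` blocks have more than `k` letters and `default` is never
  -- used.
  (((factorAt x 0 (k + 1)).flatMap m)[k]?).getD default

theorem isBlockwiseImage_image [Inhabited β] {m : α → List β} (hm : ∀ a, m a ≠ []) (x : ℕ → α) :
    IsBlockwiseImage m x (image m x) := by
  intro n
  apply List.ext_getElem (by simp)
  intro o h1 h2
  set k := blockStart m x n + o with hk
  have hnk : n ≤ k := by
    have := (blockStart_strictMono hm x).le_apply (x := n)
    omega
  obtain ⟨d, hd⟩ := Nat.exists_eq_add_of_le hnk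
  have : (factorAt x 0 (k + 1)).flatMap m =
      (factorAt x 0 n).flatMap m ++ (m (x n) ++ (factorAt x (n + 1) d).flatMap m) := by
    rw [show k + 1 = n + (d + 1) by omega, factorAt_add, List.flatMap_append, zero_add,
      factorAt_succ, List.flatMap_cons]
  rw [getElem_factorAt, image, ← hk, this,
    List.getElem?_append_right (by change blockStart m x n ≤ k; omega),
    List.getElem?_append_left (by change k - blockStart m x n < _; omega)]
  have : k - ((factorAt x 0 n).flatMap m).length = o := by
    change k - blockStart m x n = o
    omega
  rw [this, List.getElem?_eq_getElem h2, Option.getD_some]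

theorem IsRepetition.period_pos {r : List α} {p : ℕ} (h : IsRepetition r p) : 0 < p := by
  obtain ⟨u, v, n, hu, -, -, rfl⟩ := h
  exact List.length_pos_iff.2 hu

theorem IsRepetition.getElem?_add {r : List α} {p : ℕ} (h : IsRepetition r p) (j : ℕ)
    (hj : j + p < r.length) : r[j]? = r[j + p]? := by
  obtain ⟨u, v, n, hu, ⟨z, hz⟩, rfl, rfl⟩ := h
  induction n generalizing j with
  | zero =>
    have := congrArg List.length hz
    simp at this hj
    omega
  | succ n ih =>
    rw [List.replicate_succ, List.flatten_cons, List.append_assoc] at hj ⊢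
    rw [List.getElem?_append_right (Nat.le_add_left _ _), Nat.add_sub_cancel]
    rcases lt_or_ge j u.length with hju | hju
    · rw [List.getElem?_append_left hju]
      rw [List.length_append] at hj
      cases n with
      | zero =>
        simp only [List.replicate_zero, List.flatten_nil, List.nil_append] at hj ⊢
        rw [← hz, List.getElem?_append_left (by omega)]
      | succ n =>
        rw [List.replicate_succ, List.flatten_cons, List.append_assoc,
          List.getElem?_append_left hju]
    · obtain ⟨d, rfl⟩ := Nat.exists_eq_add_of_le' hju
      rw [List.getElem?_append_right (Nat.le_add_left _ _), Nat.add_sub_cancel]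
      refine ih d ?_
      rw [List.length_append] at hj
      omega

theorem IsRepetition.apply_eq {w : ℕ → α} {i n p : ℕ} (h : IsRepetition (factorAt w i n) p)
    {j : ℕ} (hj : j + p < n) : w (i + j) = w (i + p + j) := by
  have := h.getElem?_add j (by simpa using hj)
  rw [List.getElem?_eq_getElem (by simp; omega), List.getElem?_eq_getElem (by simp; omega)] at this
  simpa [add_assoc, add_comm p j] using this

/-- The infinite word `w` has a square of period `p` at position `i`. -/
def SquareAt (w : ℕ → α) (i p : ℕ) : Prop :=
  ∀ j < p, w (i + j) = w (i + p + j)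

/-- `w` contains no square. -/
def IsSquareFree (w : ℕ → α) : Prop :=
  ∀ i p, 0 < p → ¬ SquareAt w i p

theorem IsRepetition.squareAt {w : ℕ → α} {i n p : ℕ} (h : IsRepetition (factorAt w i n) p)
    (hn : 2 * p ≤ n) : SquareAt w i p :=
  fun j hj => h.apply_eq (by omega)

theorem lt_exponent_iff {r : List α} {p : ℕ} (hp : 0 < p) (e : ℕ) :
    (e : ℚ) < exponent r p ↔ e * p < r.length := by
  rw [exponent, lt_div_iff₀ (by exact_mod_cast hp)]
  exact_mod_cast Iff.rfl

theorem exponent_eq_iff {r : List α} {p : ℕ} (hp : 0 < p) (e : ℕ) :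
    exponent r p = e ↔ r.length = e * p := by
  rw [exponent, div_eq_iff (by exact_mod_cast hp.ne')]
  exact_mod_cast Iff.rfl

end Factors

/-! ### Overlap-freeness of the Thue-Morse word -/

section ThueMorse

/-- The Thue-Morse word. -/
def thueMorse (n : ℕ) : Bool :=
  n.bits.foldr xor false

@[simp]
theorem thueMorse_zero : thueMorse 0 = false := by simp [thueMorse]

@[simp]
theorem thueMorse_two_mul (n : ℕ) : thueMorse (2 * n) = thueMorse n := by
  rcases eq_or_ne n 0 with rfl | h
  · rfl
  · simp [thueMorse, Nat.bit0_bits n h]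

@[simp]
theorem thueMorse_two_mul_add_one (n : ℕ) : thueMorse (2 * n + 1) = !thueMorse n := by
  simp [thueMorse]

theorem not_thueMorse_cube (i : ℕ) :
    ¬ (thueMorse i = thueMorse (i + 1) ∧ thueMorse (i + 1) = thueMorse (i + 2)) := by
  obtain ⟨m, rfl | rfl⟩ := i.even_or_odd'
  · simp
  · rw [show 2 * m + 1 + 1 = 2 * (m + 1) by ring, show 2 * m + 1 + 2 = 2 * (m + 1) + 1 by ring]
    simp

/-- Two of the five inequalities straddle the pairs starting at `2m + 1` and `2m + 3`; they force `t
m = t (m + 1) = t (m + 2)`, a cube. -/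
theorem not_thueMorse_alternating (i : ℕ) :
    ¬ ∀ j < 5, thueMorse (i + j) ≠ thueMorse (i + j + 1) := by
  intro h
  obtain ⟨m, hm⟩ : ∃ m, i = 2 * m + 1 ∨ i + 1 = 2 * m + 1 := by
    obtain ⟨m, hm | hm⟩ := i.even_or_odd'
    · exact ⟨m, Or.inr (by omega)⟩
    · exact ⟨m, Or.inl hm⟩
  have key : ∀ k, k = 0 ∨ k = 2 → thueMorse (2 * m + 1 + k) ≠ thueMorse (2 * m + 1 + k + 1) := by
    rintro k hk
    rcases hm with hm | hm
    · rw [← hm]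
      exact h k (by omega)
    · rw [← hm, show i + 1 + k = i + (1 + k) by ring]
      exact h _ (by omega)
  have h0 := key 0 (by simp)
  have h2 := key 2 (by simp)
  rw [show 2 * m + 1 + 0 + 1 = 2 * (m + 1) by ring, add_zero] at h0
  rw [show 2 * m + 1 + 2 + 1 = 2 * (m + 2) by ring,
    show 2 * m + 1 + 2 = 2 * (m + 1) + 1 by ring] at h2
  apply not_thueMorse_cube m
  simp at h0 h2
  grind

theorem thueMorse_ne_succ_of_even {k : ℕ} (hk : Even k) : thueMorse k ≠ thueMorse (k + 1) := by
  obtain ⟨m, rfl⟩ := hk.two_dvd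
  simp

/-- The Thue-Morse word is overlap-free. -/
theorem thueMorse_overlapFree (p : ℕ) (hp : 0 < p) (i : ℕ) :
    ¬ ∀ j ≤ p, thueMorse (i + j) = thueMorse (i + p + j) := by
  induction p using Nat.strong_induction_on generalizing i with
  | _ p ih =>
  intro h
  obtain ⟨q, rfl | rfl⟩ := p.even_or_odd'
  · obtain ⟨m, rfl | rfl⟩ := i.even_or_odd'
    · refine ih q (by omega) (by omega) m fun j hj => ?_
      have := h (2 * j) (by omega)
      rwa [show 2 * m + 2 * q + 2 * j = 2 * (m + q + j) by ring,
        show 2 * m + 2 * j = 2 * (m + j) by ring, thueMorse_two_mul, thueMorse_two_mul] at this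
    · refine ih q (by omega) (by omega) m fun j hj => ?_
      have := h (2 * j) (by omega)
      rw [show 2 * m + 1 + 2 * q + 2 * j = 2 * (m + q + j) + 1 by ring,
        show 2 * m + 1 + 2 * j = 2 * (m + j) + 1 by ring] at this
      simpa using this
  · rcases Nat.eq_zero_or_pos q with rfl | hq
    · exact not_thueMorse_cube i ⟨h 0 (by omega), h 1 (by omega)⟩
    -- An odd shift changes parity, so one of the two pairs starts at an even position, where
    -- consecutive letters differ; periodicity carries this to the other pair.
    · have alt : ∀ j < 2 * q + 1, thueMorse (i + j) ≠ thueMorse (i + j + 1) ∧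
          thueMorse (i + (2 * q + 1) + j) ≠ thueMorse (i + (2 * q + 1) + j + 1) := by
        intro j hj
        have h0 := h j (by omega)
        have h1 := h (j + 1) (by omega)
        rw [← add_assoc, ← add_assoc] at h1
        rw [h0, h1, and_self]
        rcases Nat.even_or_odd (i + j) with he | ho
        · rw [← h0, ← h1]
          exact thueMorse_ne_succ_of_even he
        · refine thueMorse_ne_succ_of_even ?_
          rw [show i + (2 * q + 1) + j = i + j + (2 * q + 1) by ring]
          exact ho.add_odd ⟨q, rfl⟩
      refine not_thueMorse_alternating i fun j hj => ?_
      rcases lt_or_ge j (2 * q + 1) with hj' | hj'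
      · exact (alt j hj').1
      · have := (alt (j - (2 * q + 1)) (by omega)).2
        rwa [show i + (2 * q + 1) + (j - (2 * q + 1)) = i + j by omega] at this

end ThueMorse

/-! ### The Hall-Thue word: fixed point, square-freeness, forbidden factors -/

section HallThue

/-- The Hall-Thue word, coded by the differences of consecutive letters of the Thue-Morse word. -/
def hallThue (n : ℕ) : Fin 3 :=
  match thueMorse n, thueMorse (n + 1) with
  | false, true => 0
  | true, false => 2
  | _, _ => 1

theorem hallThue_zero : hallThue 0 = 0 := by
  have : thueMorse 1 = true := by simpa using thueMorse_two_mul_add_one 0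
  simp [hallThue, this]

theorem hallThue_one : hallThue 1 = 1 := by
  have h1 : thueMorse 1 = true := by simpa using thueMorse_two_mul_add_one 0
  have h2 : thueMorse 2 = true := by simpa [h1] using thueMorse_two_mul 1
  simp [hallThue, h1, h2]

theorem hallThueMorphism_ne_nil (a : Fin 3) : hallThueMorphism a ≠ [] := by
  revert a; decide

/-- The image of the letter `a` has length `3 - a`, and `b n = 1 + t n - t (n + 1)`, so the lengths
telescope. -/
theorem blockStart_hallThue (n : ℕ) :
    blockStart hallThueMorphism hallThue n = 2 * n + (thueMorse n).toNat := by
  induction n with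
  | zero => simp
  | succ n ih =>
    rw [blockStart_succ, ih, hallThue]
    cases thueMorse n <;> cases thueMorse (n + 1) <;> simp [hallThueMorphism] <;> ring

/-- The `n`-th block only involves `t` from `2n` to `2n + 3`, hence only `t n` and `t (n + 1)`. -/
theorem isBlockwiseImage_hallThue : IsBlockwiseImage hallThueMorphism hallThue hallThue := by
  intro n
  rw [blockStart_hallThue]
  have e0 := thueMorse_two_mul n
  have e2 := thueMorse_two_mul (n + 1)
  have e3 := thueMorse_two_mul_add_one (n + 1)
  rw [show 2 * (n + 1) = 2 * n + 2 by ring] at e2 e3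
  have H : hallThue n = match thueMorse n, thueMorse (n + 1) with
    | false, true => 0
    | true, false => 2
    | _, _ => 1 := rfl
  cases h0 : thueMorse n <;> cases h1 : thueMorse (n + 1) <;>
    simp only [h0, h1] at H e0 e2 e3 <;>
    rw [H] <;>
    simp [hallThueMorphism, factorAt_succ, factorAt_zero, hallThue, h0, e0, e2, e3, add_assoc]

theorem isHallThue_hallThue : IsHallThue hallThue :=
  ⟨hallThue_zero, isBlockwiseImage_hallThue.isImage hallThueMorphism_ne_nil⟩

/-- The integer value of a bit. -/
def bitVal (c : Bool) : ℤ := c.toNat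

theorem bitVal_thueMorse_succ (n : ℕ) :
    bitVal (thueMorse (n + 1)) = bitVal (thueMorse n) + 1 - ((hallThue n : ℕ) : ℤ) := by
  rw [hallThue]
  cases thueMorse n <;> cases thueMorse (n + 1) <;> simp [bitVal]

theorem bitVal_mem (c : Bool) : bitVal c = 0 ∨ bitVal c = 1 := by
  cases c <;> simp [bitVal]

theorem bitVal_injective : Function.Injective bitVal := by
  intro a c
  cases a <;> cases c <;> simp [bitVal]

theorem hallThue_isSquareFree : IsSquareFree hallThue := by
  intro i p hp h
  have key : ∀ j ≤ p, bitVal (thueMorse (i + p + j)) - bitVal (thueMorse (i + j)) =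
      bitVal (thueMorse (i + p)) - bitVal (thueMorse i) := by
    intro j
    induction j with
    | zero => simp
    | succ j ih =>
      intro hj
      rw [← add_assoc, ← add_assoc, bitVal_thueMorse_succ, bitVal_thueMorse_succ, h j (by omega)]
      linarith [ih (by omega)]
  have hlast := key p le_rfl
  -- The same difference occurs from `i` to `i + p` and from `i + p` to `i + 2p`; twice it is a
  -- difference of bits, so it vanishes.
  have h0 : bitVal (thueMorse (i + p)) - bitVal (thueMorse i) = 0 := by
    rcases bitVal_mem (thueMorse i) with a | a <;>
    rcases bitVal_mem (thueMorse (i + p)) with c | c <;>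
    rcases bitVal_mem (thueMorse (i + p + p)) with d | d <;> omega
  refine thueMorse_overlapFree p hp i fun j hj => bitVal_injective ?_
  linarith [key j hj]

theorem hallThue_avoids_212 (i : ℕ) : factorAt hallThue i 3 ≠ [2, 1, 2] := by
  simp only [factorAt_succ, factorAt_zero, hallThue, ne_eq]
  cases thueMorse i <;> cases thueMorse (i + 1) <;> cases thueMorse (i + 1 + 1) <;>
    cases thueMorse (i + 1 + 1 + 1) <;> decide

theorem hallThue_avoids_010 (i : ℕ) : factorAt hallThue i 3 ≠ [0, 1, 0] := by
  simp only [factorAt_succ, factorAt_zero, hallThue, ne_eq]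
  cases thueMorse i <;> cases thueMorse (i + 1) <;> cases thueMorse (i + 1 + 1) <;>
    cases thueMorse (i + 1 + 1 + 1) <;> decide

/-- The word `u` starts neither with a square of period at most `3` nor with `010` or `212`. -/
def HasAllowedStart (u : List (Fin 3)) : Prop :=
  (∀ p ∈ [1, 2, 3], 2 * p ≤ u.length → u.take p ≠ (u.drop p).take p) ∧
    u.take 3 ≠ [0, 1, 0] ∧ u.take 3 ≠ [2, 1, 2]

instance : DecidablePred HasAllowedStart := fun u => by
  unfold HasAllowedStart
  infer_instance

/-- The words of length `n` all of whose suffixes have an allowed start. -/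
def allowedWords : ℕ → List (List (Fin 3))
  | 0 => [[]]
  | n + 1 => (allowedWords n).flatMap fun u =>
      ([0, 1, 2].map fun a => a :: u).filter fun v => decide (HasAllowedStart v)

theorem hasAllowedStart_factorAt_hallThue (i n : ℕ) :
    HasAllowedStart (factorAt hallThue i n) := by
  have three : ∀ v : List (Fin 3), v.length = 3 → (factorAt hallThue i n).take 3 = v →
      factorAt hallThue i 3 = v := by
    intro v hv h
    have := congrArg List.length h
    simp only [List.length_take, length_factorAt, hv] at this
    rwa [take_factorAt _ _ (by omega)] at h
  refine ⟨fun p hp hpn h => ?_, fun h => hallThue_avoids_010 i (three _ rfl h),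
    fun h => hallThue_avoids_212 i (three _ rfl h)⟩
  rw [length_factorAt] at hpn
  rw [drop_factorAt, take_factorAt _ _ (by omega), take_factorAt _ _ (by omega),
    factorAt_eq_iff] at h
  refine hallThue_isSquareFree i p ?_ h
  simp at hp
  omega

/-- This reduces statements about all factors of a given length to a finite check. -/
theorem factorAt_hallThue_mem_allowedWords (i n : ℕ) :
    factorAt hallThue i n ∈ allowedWords n := by
  induction n generalizing i with
  | zero => simp [factorAt, allowedWords]
  | succ n ih =>
    have h := hasAllowedStart_factorAt_hallThue i (n + 1)
    rw [factorAt_succ] at h ⊢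
    rw [allowedWords, List.mem_flatMap]
    refine ⟨_, ih (i + 1), List.mem_filter.2 ⟨List.mem_map.2 ⟨_, ?_, rfl⟩, decide_eq_true h⟩⟩
    generalize hallThue i = a
    revert a
    decide

end HallThue

/-! ### Squares and overlaps in the image under `g4` -/

section G4

theorem g4_ne_nil (a : Fin 3) : g4 a ≠ [] := by
  revert a; decide

/-- The length of the longest common prefix of `g4 a` and `g4 c` for `a ≠ c`, which is also that
of their longest common suffix. -/
def commonLength (a c : Fin 3) : ℕ :=
  if a = 2 ∨ c = 2 then 2 else 8

theorem g4_prefix_mismatch : ∀ a c : Fin 3, a ≠ c →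
    commonLength a c < (g4 a).length ∧ commonLength a c < (g4 c).length ∧
      (g4 a)[commonLength a c]? ≠ (g4 c)[commonLength a c]? := by
  decide

theorem g4_suffix_mismatch : ∀ a c : Fin 3, a ≠ c →
    commonLength a c < (g4 a).length ∧ commonLength a c < (g4 c).length ∧
      (g4 a)[(g4 a).length - 1 - commonLength a c]? ≠
        (g4 c)[(g4 c).length - 1 - commonLength a c]? := by
  decide

/-- Nine letters are needed because `g4 0` and `g4 1` share their first eight. -/
theorem g4_synchronizing : ∀ u ∈ allowedWords 3, ∀ v ∈ allowedWords 3,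
    9 ≤ (v.flatMap g4).length ∧ ∀ o < (u.head?.elim [] g4).length,
      9 ≤ ((u.flatMap g4).drop o).length ∧
        (((u.flatMap g4).drop o).take 9 = (v.flatMap g4).take 9 → o = 0 ∧ u.head? = v.head?) := by
  decide +kernel

/-- The only squares of period less than `26` at the start of `s` are `00`, `11`, `001001` and
`110110`, and `s` starts neither with a fourth power of a letter nor with a word of period `3` and
length `7`. -/
def HasFewShortSquares (s : List (Fin 2)) : Prop :=
  50 ≤ s.length ∧ s.take 4 ≠ [0, 0, 0, 0] ∧ s.take 4 ≠ [1, 1, 1, 1] ∧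
    ∀ q < 25, s.take (q + 1) = (s.drop (q + 1)).take (q + 1) → q = 0 ∨
      q = 2 ∧ (s.take 6 = [0, 0, 1, 0, 0, 1] ∨ s.take 6 = [1, 1, 0, 1, 1, 0]) ∧
        s.take 4 ≠ (s.drop 3).take 4

instance : DecidablePred HasFewShortSquares := fun s => by
  unfold HasFewShortSquares
  infer_instance

theorem g4_hasFewShortSquares : ∀ u ∈ allowedWords 8, ∀ o < (u.head?.elim [] g4).length,
    HasFewShortSquares ((u.flatMap g4).drop o) := by
  decide +kernel

theorem length_g4_le (a : Fin 3) : (g4 a).length ≤ 17 := by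
  revert a; decide

variable {w : ℕ → Fin 2}

theorem head?_factorAt_elim (n d : ℕ) :
    ((factorAt hallThue n (d + 1)).head?.elim [] g4) = g4 (hallThue n) := by
  simp [factorAt_succ]

theorem drop_flatMap_factorAt (hw : IsBlockwiseImage g4 hallThue w) (n d o : ℕ) :
    ((factorAt hallThue n d).flatMap g4).drop o =
      factorAt w (blockStart g4 hallThue n + o)
        (((factorAt hallThue n d).flatMap g4).length - o) := by
  rw [← drop_factorAt, hw.factorAt_blockStart]

theorem exists_blockStart_of_factorAt_eq (hw : IsBlockwiseImage g4 hallThue w) {n k : ℕ}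
    (h : factorAt w k 9 = factorAt w (blockStart g4 hallThue n) 9) :
    ∃ n', k = blockStart g4 hallThue n' ∧ hallThue n' = hallThue n := by
  obtain ⟨n', o, ho, rfl⟩ := exists_mem_block g4_ne_nil hallThue k
  have hv := factorAt_hallThue_mem_allowedWords n 3
  have hu := factorAt_hallThue_mem_allowedWords n' 3
  obtain ⟨hl, H⟩ := g4_synchronizing _ hu _ hv
  rw [head?_factorAt_elim] at H
  obtain ⟨hl', H⟩ := H o ho
  have e := drop_flatMap_factorAt hw n 3 0
  rw [List.drop_zero, add_zero, Nat.sub_zero] at e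
  rw [drop_flatMap_factorAt hw] at hl' H
  rw [length_factorAt] at hl'
  rw [e, take_factorAt _ _ hl', take_factorAt _ _ hl] at H
  obtain ⟨rfl, h0⟩ := H h
  exact ⟨n', rfl, by simpa [factorAt_succ] using h0⟩

theorem hasFewShortSquares_factorAt (hw : IsBlockwiseImage g4 hallThue w) (k : ℕ) :
    ∃ N, HasFewShortSquares (factorAt w k N) := by
  obtain ⟨n, o, ho, rfl⟩ := exists_mem_block g4_ne_nil hallThue k
  have H := g4_hasFewShortSquares _ (factorAt_hallThue_mem_allowedWords n 8)
  rw [head?_factorAt_elim] at H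
  have H := H o ho
  rw [drop_flatMap_factorAt hw] at H
  exact ⟨_, H⟩

/-- If `g4 a` and `g4 c` start at distance `p` and `a ≠ c`, a run of period `p` ends early in the
first of the two blocks. -/
theorem run_end_le (hw : IsBlockwiseImage g4 hallThue w) {i p n n' : ℕ}
    (hn : blockStart g4 hallThue n + p = blockStart g4 hallThue n')
    (hne : hallThue n ≠ hallThue n')
    (h : ∀ k, blockStart g4 hallThue n ≤ k → k < i → w k = w (k + p)) :
    i ≤ blockStart g4 hallThue n + commonLength (hallThue n) (hallThue n') := by
  by_contra! hlt
  obtain ⟨h1, h2, h3⟩ := g4_prefix_mismatch _ _ hne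
  rw [hw.getElem? h1, hw.getElem? h2] at h3
  refine h3 (congrArg some ?_)
  rw [h _ (Nat.le_add_right _ _) hlt, ← hn]
  congr 1
  ring

/-- If `g4 a` and `g4 c` end at distance `p` and `a ≠ c`, a run of period `p` starts late in the
first of the two blocks. -/
theorem le_run_start (hw : IsBlockwiseImage g4 hallThue w) {i p n n' : ℕ}
    (hn : blockStart g4 hallThue (n + 1) + p = blockStart g4 hallThue (n' + 1))
    (hne : hallThue n ≠ hallThue n')
    (h : ∀ k, i ≤ k → k < blockStart g4 hallThue (n + 1) → w k = w (k + p)) :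
    blockStart g4 hallThue (n + 1) ≤ i + commonLength (hallThue n) (hallThue n') := by
  by_contra! hlt
  obtain ⟨h1, h2, h3⟩ := g4_suffix_mismatch _ _ hne
  rw [hw.getElem? (by omega), hw.getElem? (by omega)] at h3
  refine h3 (congrArg some ?_)
  rw [blockStart_succ] at hn hlt h
  rw [blockStart_succ] at hn
  rw [h _ (by omega) (by omega)]
  congr 1
  omega

/-- A long square of `w` yields equal letters `b m = b m'` whose blocks are at distance `p`, and
whose left neighbours differ if the run of period `p` does not reach back to `m`. -/
theorem exists_aligned_blocks (hw : IsBlockwiseImage g4 hallThue w) {i p : ℕ} (hp : 26 ≤ p)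
    (h : SquareAt w i p) :
    ∃ m m', blockStart g4 hallThue m + p = blockStart g4 hallThue m' ∧
      hallThue m = hallThue m' ∧
      (∀ k, blockStart g4 hallThue m ≤ k → k < i + p → w k = w (k + p)) ∧
      (blockStart g4 hallThue m ≤ i ∨
        ∃ l l', m = l + 1 ∧ m' = l' + 1 ∧ hallThue l ≠ hallThue l' ∧
          blockStart g4 hallThue m ≤ i + commonLength (hallThue l) (hallThue l')) := by
  have h' : ∀ k, i ≤ k → k < i + p → w k = w (k + p) := by
    intro k hk hkp
    have := h (k - i) (by omega)
    rwa [show i + (k - i) = k by omega, show i + p + (k - i) = k + p by omega] at this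
  obtain ⟨l, o, ho, rfl⟩ := exists_mem_block g4_ne_nil hallThue i
  set S := blockStart g4 hallThue with hS
  have hsucc : S (l + 1) = S l + (g4 (hallThue l)).length := blockStart_succ _ _ _
  have hle := length_g4_le (hallThue l)
  -- The bound 26 is 17 + 9: at most 17 letters reach the next block boundary, and the synchronizing
  -- window has nine.
  have hwin : factorAt w (S (l + 1) + p) 9 = factorAt w (S (l + 1)) 9 := by
    rw [factorAt_eq_iff]
    intro j hj
    rw [h' (S (l + 1) + j) (by omega) (by omega)]
    congr 1
    ring
  obtain ⟨n', hn', hb⟩ := exists_blockStart_of_factorAt_eq hw hwin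
  rw [← hS] at hn'
  obtain ⟨l', rfl⟩ : ∃ l', n' = l' + 1 := Nat.exists_eq_succ_of_ne_zero fun h0 => by
    rw [h0, hS, blockStart_zero] at hn'
    omega
  -- If the blocks containing the two starts agree, the run extends left to their beginnings;
  -- otherwise alignment begins one block later.
  by_cases hll : hallThue l = hallThue l'
  · have hsucc' : S (l' + 1) = S l' + (g4 (hallThue l')).length := blockStart_succ _ _ _
    rw [← hll] at hsucc'
    have hd : S l + p = S l' := by omega
    refine ⟨l, l', hd, hll, fun k hk hkp => ?_, Or.inl (Nat.le_add_right _ _)⟩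
    rcases lt_or_ge k (S (l + 1)) with hk1 | hk1
    · have e1 := hw.getElem? (n := l) (o := k - S l) (by omega)
      have e2 := hw.getElem? (n := l') (o := k - S l) (by rw [← hll]; omega)
      rw [← hll, e1, Option.some_inj, ← hS, ← hd] at e2
      rwa [show S l + (k - S l) = k by omega, show S l + p + (k - S l) = k + p by omega] at e2
    · exact h' k (by omega) hkp
  · refine ⟨l + 1, l' + 1, hn', hb.symm, fun k hk hkp => h' k (by omega) hkp,
      Or.inr ⟨l, l', rfl, rfl, hll, ?_⟩⟩
    exact le_run_start hw hn' hll fun k hk hk' => h' k hk (by rw [← hS] at hk'; omega)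

theorem hallThue_ne_succ (n : ℕ) : hallThue n ≠ hallThue (n + 1) := by
  intro h
  refine hallThue_isSquareFree n 1 one_pos fun j hj => ?_
  obtain rfl : j = 0 := by omega
  exact h

theorem g4_length_gap : ∀ a c : Fin 3, a ≠ c → 17 ≤ (g4 a).length + (g4 c).length := by
  decide

theorem commonLength_le (a c : Fin 3) : commonLength a c ≤ 8 := by
  revert a c; decide

/-- No letter `y` fits between two occurrences of a factor `x` of the Hall-Thue word in such a way
that the image of `x y x` extends to a square. -/
theorem g4_length_le_commonLength : ∀ y a c : Fin 3, a ≠ y → c ≠ y →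
    (g4 y).length ≤ commonLength a y + commonLength y c → y = 1 ∧ a = 0 ∧ c = 0 := by
  decide

theorem commonLength_lt_g4_length : ∀ y c : Fin 3, commonLength y c < (g4 y).length := by
  decide

theorem not_squareAt_of_le (hw : IsBlockwiseImage g4 hallThue w) {i p : ℕ} (hp : 26 ≤ p) :
    ¬ SquareAt w i p := by
  intro h
  obtain ⟨m, m', hmp, hb, hrun, hleft⟩ := exists_aligned_blocks hw hp h
  have hmono := blockStart_strictMono g4_ne_nil hallThue
  have hsucc := blockStart_succ g4 hallThue
  have hmm : m < m' := hmono.lt_iff_lt.1 (by omega)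
  obtain ⟨q, rfl⟩ := Nat.exists_eq_add_of_lt hmm
  have hex : ∃ r, hallThue (m + r) ≠ hallThue (m + q + 1 + r) := by
    by_contra! hall
    exact hallThue_isSquareFree m (q + 1) q.succ_pos fun j _ => hall j
  -- The repeated word `x` is the maximal common factor of length `r` read from `m` and `m + q + 1`.
  obtain ⟨r, hrne, hrmin⟩ : ∃ r, hallThue (m + r) ≠ hallThue (m + q + 1 + r) ∧
      ∀ j < r, hallThue (m + j) = hallThue (m + q + 1 + j) :=
    ⟨Nat.find hex, Nat.find_spec hex, fun j hj => not_not.1 (Nat.find_min hex hj)⟩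
  have hrq : r ≤ q := by
    by_contra! hlt
    exact hallThue_isSquareFree m (q + 1) q.succ_pos fun j hj => hrmin j (by omega)
  have hr0 : r ≠ 0 := fun h0 => hrne (by rw [h0]; exact hb)
  have hshift : ∀ j ≤ r,
      blockStart g4 hallThue (m + j) + p = blockStart g4 hallThue (m + q + 1 + j) := by
    intro j
    induction j with
    | zero => exact fun _ => hmp
    | succ j ih =>
      intro hj
      rw [← add_assoc, ← add_assoc, hsucc, hsucc, ← ih (by omega), hrmin j (by omega)]
      ring
  have hright := run_end_le (i := i + p) hw (hshift r le_rfl) hrne fun k hk hkp =>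
    hrun k ((hmono.monotone (Nat.le_add_right m r)).trans hk) hkp
  have hF := commonLength_le (hallThue (m + r)) (hallThue (m + q + 1 + r))
  -- Exactly one letter separates the two copies of `x`: the run overshoots their images by at most
  -- 8 letters at each end, while two consecutive blocks have total length at least 17.
  have hrq' : r = q := by
    by_contra hne
    have h2 := hmono.monotone (show m + r + 2 ≤ m + q + 1 by omega)
    have := g4_length_gap _ _ (hallThue_ne_succ (m + r))
    rw [show m + r + 2 = m + r + 1 + 1 by ring, hsucc, hsucc] at h2
    rcases hleft with hl | ⟨l, l', -, -, -, hl⟩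
    · omega
    · have := commonLength_le (hallThue l) (hallThue l')
      omega
  subst hrq'
  have hlen := hsucc (m + r)
  rcases hleft with hl | ⟨l, l', rfl, hl', hll, hl⟩
  · have := commonLength_lt_g4_length (hallThue (m + r)) (hallThue (m + r + 1 + r))
    omega
  -- Now `b` contains `a x y x c` with `a ≠ y` and `c ≠ y`, and the lengths force `0x1x0`. The first
  -- letter of `x` follows both `0` and `1`, its last precedes both, so both are `2` and `x1x`
  -- contains `212`.
  · obtain rfl : l' = l + 1 + r := by omega
    obtain ⟨hy, ha, hc⟩ := g4_length_le_commonLength _ _ _ hll hrne.symm (by omega)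
    obtain ⟨s, hs⟩ := Nat.exists_eq_succ_of_ne_zero hr0
    have other : ∀ x : Fin 3, x ≠ 0 → x ≠ 1 → x = 2 := by decide
    have h2 : hallThue (l + 1 + r + 1) = 2 := by
      refine other _ ?_ ?_
      · rw [← hb, ← ha]
        exact (hallThue_ne_succ l).symm
      · rw [← hy]
        exact (hallThue_ne_succ _).symm
    have h3 : hallThue (l + 1 + s) = 2 := by
      refine other _ ?_ ?_
      · rw [hrmin s (by omega), ← hc, show l + 1 + r + 1 + r = l + 1 + r + 1 + s + 1 by omega]
        exact hallThue_ne_succ _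
      · rw [← hy, show l + 1 + r = l + 1 + s + 1 by omega]
        exact hallThue_ne_succ _
    apply hallThue_avoids_212 (l + 1 + s)
    rw [factorAt_succ, factorAt_succ, factorAt_one, h3, show l + 1 + s + 1 = l + 1 + r by omega,
      hy, h2]

theorem factorAt_four_ne (hw : IsBlockwiseImage g4 hallThue w) (k : ℕ) (a : Fin 2) :
    factorAt w k 4 ≠ [a, a, a, a] := by
  obtain ⟨N, hN, h0, h1, -⟩ := hasFewShortSquares_factorAt hw k
  rw [length_factorAt] at hN
  rw [take_factorAt _ _ (by omega)] at h0 h1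
  fin_cases a
  exacts [h0, h1]

theorem SquareAt.period (hw : IsBlockwiseImage g4 hallThue w) {k p : ℕ} (hp : 0 < p)
    (h : SquareAt w k p) : p = 1 ∨ p = 3 ∧
      (factorAt w k 6 = [0, 0, 1, 0, 0, 1] ∨ factorAt w k 6 = [1, 1, 0, 1, 1, 0]) ∧
      factorAt w k 4 ≠ factorAt w (k + 3) 4 := by
  have hp26 : p < 26 := not_le.1 fun hle => not_squareAt_of_le hw hle h
  obtain ⟨q, rfl⟩ := Nat.exists_eq_succ_of_ne_zero hp.ne'
  obtain ⟨N, hN, -, -, H⟩ := hasFewShortSquares_factorAt hw k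
  rw [length_factorAt] at hN
  have H := H q (by omega)
  rw [drop_factorAt, drop_factorAt, take_factorAt _ _ (by omega), take_factorAt _ _ (by omega),
    take_factorAt _ _ (by omega), take_factorAt _ _ (by omega), take_factorAt _ _ (by omega),
    factorAt_eq_iff] at H
  rcases H h with rfl | ⟨rfl, H3⟩
  · exact Or.inl rfl
  · exact Or.inr ⟨rfl, H3⟩

/-- An overlap of `w` is the cube of a letter. -/
theorem eq_cube_of_two_mul_lt (hw : IsBlockwiseImage g4 hallThue w) {i n p : ℕ}
    (h : IsRepetition (factorAt w i n) p) (hn : 2 * p < n) :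
    p = 1 ∧ n = 3 ∧ (factorAt w i n = [0, 0, 0] ∨ factorAt w i n = [1, 1, 1]) := by
  rcases (h.squareAt hn.le).period hw h.period_pos with rfl | ⟨rfl, -, hne⟩
  · have e0 : w i = w (i + 1) := h.apply_eq (j := 0) (by omega)
    have e1 : w (i + 1) = w (i + 1 + 1) := h.apply_eq (j := 1) (by omega)
    obtain rfl : n = 3 := by
      by_contra hn3
      have e2 : w (i + 1 + 1) = w (i + 1 + 1 + 1) := h.apply_eq (j := 2) (by omega)
      refine factorAt_four_ne hw i (w i) ?_
      simp only [factorAt_succ, factorAt_zero]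
      rw [← e2, ← e1, ← e0]
    refine ⟨rfl, rfl, ?_⟩
    simp only [factorAt_succ, factorAt_zero]
    rw [← e1, ← e0]
    generalize w i = a
    revert a
    decide
  · exact absurd ((factorAt_eq_iff _ _ _ _).2 fun j hj => h.apply_eq (by omega)) hne

theorem eq_of_isSquareOfPeriod (hw : IsBlockwiseImage g4 hallThue w) {r : List (Fin 2)} {p : ℕ}
    (hr : IsFactor r w) (h : IsSquareOfPeriod r p) :
    p = 1 ∧ (r = [0, 0] ∨ r = [1, 1]) ∨
      p = 3 ∧ (r = [0, 0, 1, 0, 0, 1] ∨ r = [1, 1, 0, 1, 1, 0]) := by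
  obtain ⟨hrep, hexp⟩ := h
  have hlen : r.length = 2 * p := (exponent_eq_iff hrep.period_pos 2).1 (by exact_mod_cast hexp)
  obtain ⟨i, hi⟩ := hr
  rw [hlen] at hi
  rw [hi] at hrep ⊢
  have hsq := hrep.squareAt le_rfl
  rcases hsq.period hw hrep.period_pos with rfl | ⟨rfl, H, -⟩
  · refine Or.inl ⟨rfl, ?_⟩
    have e0 : w i = w (i + 1) := hsq 0 (by omega)
    simp only [Nat.mul_one, factorAt_succ, factorAt_zero]
    rw [← e0]
    generalize w i = a
    revert a
    decide
  · exact Or.inr ⟨rfl, H⟩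

/-- Since `b` starts with `01`, this prefix of `w` already exhibits both overlaps and all four
squares. -/
theorem isFactor_of_isInfix (hw : IsBlockwiseImage g4 hallThue w) {r : List (Fin 2)}
    (h : r <:+: g4 0 ++ g4 1) : IsFactor r w := by
  have e := hw.factorAt_blockStart 0 2
  rw [factorAt_succ, factorAt_one, hallThue_zero, hallThue_one] at e
  simp only [List.flatMap_cons, List.flatMap_nil, List.append_nil, blockStart_zero] at e
  obtain ⟨s, t, hst⟩ := h
  have hl : (g4 0 ++ g4 1).length = s.length + r.length + t.length := by
    rw [← hst, List.length_append, List.length_append]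
  rw [← hst, List.append_assoc] at e
  refine ⟨s.length, ?_⟩
  have := congrArg (fun z => (z.drop s.length).take r.length) e
  simp only [List.drop_left, List.take_left] at this
  rw [drop_factorAt, take_factorAt _ _ (by simp), zero_add] at this
  exact this.symm

theorem isPlusFree_three (hw : IsBlockwiseImage g4 hallThue w) : IsPlusFree 3 w := by
  rintro r p ⟨i, hi⟩ hrep
  by_contra! hlt
  have hlen := (lt_exponent_iff hrep.period_pos 3).1 (by exact_mod_cast hlt)
  rw [hi] at hrep
  obtain ⟨rfl, hn, -⟩ := eq_cube_of_two_mul_lt hw hrep (by omega)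
  omega

theorem setOf_overlaps (hw : IsBlockwiseImage g4 hallThue w) :
    {r : List (Fin 2) | IsFactor r w ∧ IsOverlap r} = {[0, 0, 0], [1, 1, 1]} := by
  ext r
  simp only [Set.mem_ofPred_eq, Set.mem_insert_iff, Set.mem_singleton_iff]
  constructor
  · rintro ⟨⟨i, hi⟩, p, hrep, hexp⟩
    have hlen := (lt_exponent_iff hrep.period_pos 2).1 (by exact_mod_cast hexp)
    rw [hi] at hrep ⊢
    exact (eq_cube_of_two_mul_lt hw hrep hlen).2.2
  · rintro (rfl | rfl)
    · exact ⟨isFactor_of_isInfix hw (by decide), 1,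
        ⟨[0], [], 3, by simp, by simp, rfl, rfl⟩, by norm_num [exponent]⟩
    · exact ⟨isFactor_of_isInfix hw (by decide), 1,
        ⟨[1], [], 3, by simp, by simp, rfl, rfl⟩, by norm_num [exponent]⟩

theorem setOf_squares (hw : IsBlockwiseImage g4 hallThue w) :
    {r : List (Fin 2) | IsFactor r w ∧ IsSquareWord r} =
      {[0, 0], [1, 1], [0, 0, 1, 0, 0, 1], [1, 1, 0, 1, 1, 0]} := by
  ext r
  simp only [Set.mem_ofPred_eq, Set.mem_insert_iff, Set.mem_singleton_iff]
  constructor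
  · rintro ⟨hr, p, h⟩
    rcases eq_of_isSquareOfPeriod hw hr h with ⟨-, h | h⟩ | ⟨-, h | h⟩ <;> simp [h]
  · rintro (rfl | rfl | rfl | rfl)
    · exact ⟨isFactor_of_isInfix hw (by decide), 1,
        ⟨[0], [], 2, by simp, by simp, rfl, rfl⟩, by norm_num [exponent]⟩
    · exact ⟨isFactor_of_isInfix hw (by decide), 1,
        ⟨[1], [], 2, by simp, by simp, rfl, rfl⟩, by norm_num [exponent]⟩
    · exact ⟨isFactor_of_isInfix hw (by decide), 3,
        ⟨[0, 0, 1], [], 2, by simp, by simp, rfl, rfl⟩, by norm_num [exponent]⟩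
    · exact ⟨isFactor_of_isInfix hw (by decide), 3,
        ⟨[1, 1, 0], [], 2, by simp, by simp, rfl, rfl⟩, by norm_num [exponent]⟩

end G4

end InfWord

theorem mainTheorem9 :
    ∃ (b : ℕ → Fin 3) (w : ℕ → Fin 2),
      InfWord.IsHallThue b ∧
      InfWord.IsImage InfWord.g4 b w ∧
      InfWord.IsPlusFree 3 w ∧
      {r : List (Fin 2) | InfWord.IsFactor r w ∧ InfWord.IsOverlap r}.encard = 2 ∧
      {r : List (Fin 2) | InfWord.IsFactor r w ∧ InfWord.IsSquareWord r}.encard = 4 ∧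
      ∀ (r : List (Fin 2)) (p : ℕ),
        InfWord.IsFactor r w → InfWord.IsSquareOfPeriod r p → ¬ Even p := by
  have hw := InfWord.isBlockwiseImage_image InfWord.g4_ne_nil InfWord.hallThue
  refine ⟨InfWord.hallThue, _, InfWord.isHallThue_hallThue, hw.isImage InfWord.g4_ne_nil,
    InfWord.isPlusFree_three hw, ?_, ?_, fun r p hr h => ?_⟩
  · rw [InfWord.setOf_overlaps hw]
    exact Set.encard_pair (by decide)
  · rw [InfWord.setOf_squares hw, Set.encard_insert_of_notMem (by simp),
      Set.encard_insert_of_notMem (by simp), Set.encard_pair (by decide)]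
    norm_num
  · rcases InfWord.eq_of_isSquareOfPeriod hw hr h with ⟨rfl, -⟩ | ⟨rfl, -⟩ <;> decide
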